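/- Let $T$ be a tree (a connected graph without cycles) in which every vertex has finitely many neighbours, with a root vertex $o$ that has exactly one neighbour; the edge at $o$ is the root edge $\omega$. Write $E(T)$ for the set of edges. The edges are ordered by $\alpha\le\beta$ if $\alpha$ lies on the geodesic from $o$ through $\beta$; the level $|\alpha|$ is the number of edges strictly preceding $\alpha$ (so $|\omega|=0$), and $\deg(\alpha)$ is the number of edges departing, away from the root, from the end vertex of $\alpha$. The boundary $\partial T$ consists of the infinite geodesics starting at $o$, together with the leaves (the edges that are maximal for $\le$), if there are any. For $\zeta\in\partial T$ let $P(\zeta)$ be the set of edges of the geodesic from $o$ to $\zeta$ (the final edge included if $\zeta$ is a leaf), and let $\partial T_\alpha=\{\zeta\in\partial T:\alpha\in P(\zeta)\}$. The sets $\partial T_\alpha$, $\alpha\in E(T)$, form a basis of the topology of $\partial T$. Let $1<p<\infty$ and $1/p+1/p'=1$. For $E\subseteq\partial T$ let $\Omega_E$ be the set of nonnegative $f\in\ell^p(E(T))$ with $\sum_{\alpha\in P(\zeta)}f(\alpha)\ge 1$ for all $\zeta\in E$, and let $c_p(E)=\inf_{f\in\Omega_E}\|f\|_p^p$. A $p$-equilibrium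 measure of $E$ is a finite positive Borel measure $\mu$ on $\partial T$, carried by $\overline E$, with $\mu(\overline E)=c_p(E)$ and such that, with $M(\alpha)=\mu(\partial T_\alpha)$ the co-potential of $\mu$, the function $M^{p'-1}$ lies in the $\ell^p$-closure of $\Omega_E$ and $\|M^{p'-1}\|_p^p=c_p(E)$. (a) Suppose that $T$ is spherically symmetric, i.e. $\deg(\alpha)$ depends only on $|\alpha|$. Then $\partial T$ has exactly one $p$-equilibrium measure, and this measure is spherically symmetric: its co-potential $M(\alpha)$ depends only on $|\alpha|$. Moreover, with $N_k$ the number of edges of level $k$, $$c_p(\partial T)=\Big(\sum_{k:\,N_k\neq 0}N_k^{1-p'}\Big)^{1-p},$$ where the right-hand side is $0$ if the series diverges. (b) If $n\ge 1$ is an integer and $T$ is homogeneous of order $n$, i.e. $\deg(\alpha)=n$ for every edge $\alpha$, then $c_p(\partial T)=\big(1-n^{1-p'}\big)^{p-1}$. -/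

import Mathlib

open MeasureTheory
open scoped ENNReal

noncomputable section

/-- A locally finite tree with a distinguished root vertex, the root being adjacent to exactly one
other vertex (through the root edge). -/
structure RootEdgeTree (V : Type*) where
  graph : SimpleGraph V
  isTree : graph.IsTree
  root : V
  root_adj : ∃! x, graph.Adj root x
  locallyFinite : ∀ x, (graph.neighborSet x).Finite

namespace RootEdgeTree

/-- The edges of `T`. As `T` is a tree, the endpoints of an edge are at distances from the root
which differ by one, so that every edge is listed exactly once, with its beginning vertex `b` and
its ending vertex `e`. -/
@[ext]
structure Edge {V : Type*} (T : RootEdgeTree V) where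
  b : V
  e : V
  adj : T.graph.Adj b e
  dist_eq : T.graph.dist T.root e = T.graph.dist T.root b + 1

variable {V : Type*} (T : RootEdgeTree V)

/-- The level `|α|`: the number of edges strictly preceding `α`. -/
def level (α : T.Edge) : ℕ := T.graph.dist T.root α.b

/-- The degree of an edge: the number of edges departing from its ending vertex. -/
def deg (α : T.Edge) : ℕ := {β : T.Edge | β.b = α.e}.ncard

/-- The number `N_k` of edges at level `k`. -/
def levelCard (k : ℕ) : ℕ := {α : T.Edge | T.level α = k}.ncard

def IsSphericallySymmetric : Prop :=
  ∀ α β : T.Edge, T.level α = T.level β → T.deg α = T.deg β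

/-- Homogeneous trees of order `n`. -/
def IsHomogeneous (n : ℕ) : Prop := ∀ α : T.Edge, T.deg α = n

/-- The predecessor set of a vertex: the edges of the geodesic from the root to `x`. -/
def vertexPred (x : V) : Set T.Edge :=
  {α | ∃ q : T.graph.Walk T.root x, q.IsPath ∧ s(α.b, α.e) ∈ q.edges}

/-- The edge order: `α ≤ β` if `α` lies on the geodesic from the root through `β`. -/
def edgeLE (α β : T.Edge) : Prop := α ∈ T.vertexPred β.e

def IsLeaf (α : T.Edge) : Prop := ∀ β : T.Edge, T.edgeLE α β → β = α

/-- The boundary: the half-infinite geodesics starting from the root, together with the leaves. -/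
inductive Boundary {V : Type*} (T : RootEdgeTree V)
  | ray (x : ℕ → V) (zero : x 0 = T.root) (adj : ∀ n, T.graph.Adj (x n) (x (n + 1)))
      (inj : Function.Injective x) : Boundary T
  | leaf (α : T.Edge) (isLeaf : T.IsLeaf α) : Boundary T

/-- The predecessor set `P(ζ)` of a boundary point. -/
def pred : T.Boundary → Set T.Edge
  | .ray x _ _ _ => {α | ∃ n, α.b = x n ∧ α.e = x (n + 1)}
  | .leaf α _ => T.vertexPred α.e

/-- The boundary `∂T_α` of the tent rooted at `α`, as a subset of `∂T`. -/
def tentBoundary (α : T.Edge) : Set T.Boundary := {ζ | α ∈ T.pred ζ}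

instance : TopologicalSpace T.Boundary :=
  TopologicalSpace.generateFrom (Set.range T.tentBoundary)

instance : MeasurableSpace T.Boundary := borel T.Boundary

instance : BorelSpace T.Boundary := ⟨rfl⟩

/-- The potential `If(ζ) = ∑_{α ∈ P(ζ)} f(α)` (of a nonnegative edge function `f`). -/
def potential (f : T.Edge → ℝ) (ζ : T.Boundary) : ℝ≥0∞ :=
  ∑' α : T.pred ζ, ENNReal.ofReal (f α)

/-- The co-potential `I*μ(α) = μ(∂T_α)`. -/
def copotential (μ : Measure T.Boundary) (α : T.Edge) : ℝ := μ.real (T.tentBoundary α)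

/-- A measure is spherically symmetric if its co-potential is constant on levels. -/
def IsSphericallySymmetricMeasure (μ : Measure T.Boundary) : Prop :=
  ∀ α β : T.Edge, T.level α = T.level β → T.copotential μ α = T.copotential μ β

/-- The space `ℓ^p` of `p`-summable functions on the edges. -/
abbrev EdgeLp (p : ℝ) := lp (fun _ : T.Edge => ℝ) (ENNReal.ofReal p)

instance fact_one_le_ofReal (p : ℝ) [h : Fact (1 < p)] : Fact (1 ≤ ENNReal.ofReal p) :=
  ⟨ENNReal.one_le_ofReal.2 h.out.le⟩

/-- The set `Ω_E` of nonnegative `ℓ^p` functions `f` with `If ≥ 1` on `E`. -/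
def testFunctions (p : ℝ) (E : Set T.Boundary) : Set (T.EdgeLp p) :=
  {f | (∀ α, 0 ≤ f α) ∧ ∀ ζ ∈ E, 1 ≤ T.potential f ζ}

/-- The `p`-capacity of a subset of the boundary. -/
def capacity (p : ℝ) (E : Set T.Boundary) : ℝ≥0∞ :=
  ⨅ f ∈ T.testFunctions p E, ENNReal.ofReal (‖f‖ ^ p)

/-- `f` is a `p`-equilibrium function of `E`: it lies in the `ℓ^p`-closure of `Ω_E` and
`‖f‖_p^p = c_p(E)`. -/
def IsEquilibriumFunction (p : ℝ) [Fact (1 < p)] (E : Set T.Boundary) (f : T.EdgeLp p) : Prop :=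
  f ∈ closure (T.testFunctions p E) ∧ ENNReal.ofReal (‖f‖ ^ p) = T.capacity p E

/-- `μ` is a `p`-equilibrium measure of `E`: a finite positive Borel measure, carried by the
closure of `E`, with total mass `c_p(E)`, such that `M_p = (I*μ)^(p' - 1)` is a `p`-equilibrium
function of `E`. -/
structure IsEquilibriumMeasure (p : ℝ) [Fact (1 < p)] (E : Set T.Boundary)
    (μ : Measure T.Boundary) : Prop where
  finite : IsFiniteMeasure μ
  support : μ (closure E)ᶜ = 0
  mass : μ (closure E) = T.capacity p E
  equilibrium : ∃ f : T.EdgeLp p, (∀ α, f α = T.copotential μ α ^ (p.conjExponent - 1)) ∧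
    T.IsEquilibriumFunction p E f

end RootEdgeTree

end

/-!
Every boundary point is encoded by its predecessor set, a branch which descends from the root edge
and stops at a leaf only.

*Lower bound.* For a measure `μ` and `f ∈ Ω_E`, integrating `I f ≥ 1` over `E` and exchanging sum
and integral gives `μ E ≤ ∑ f(α) μ(∂T_α)`, so Hölder's inequality yields
`μ E ^ p ≤ ‖f‖_p ^ p (∑ μ(∂T_α) ^ p') ^ (p - 1)`. In a spherically symmetric tree it is applied to
the visibility measure, the law of the end of a uniform random descent, which gives mass `1 / N_k`
to each tent rooted at level `k`; the last sum is then `S = ∑ N_k ^ (1 - p')`.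

*Upper bound.* A branch meets every nonempty level, hence the radial function with value
`N_k ^ (1 - p') / S_m` on the levels `k ≤ m`, where `S_m` is the partial sum of `S`, is a test
function; its `p`-norm to the `p` is `S_m ^ (1 - p)`. If `S < ∞`, the choice `m = ∞` is optimal and
equals `M ^ (p' - 1)` for the co-potential `M` of `c_p(∂T)` times the visibility measure; if
`S = ∞`, the capacity vanishes and so does the equilibrium measure.

*Uniqueness.* `f ↦ ‖f‖_p ^ p` is strictly convex, so it has at most one minimizer on the closed
convex set `closure Ω_E`; hence the co-potential of an equilibrium measure is determined, and so is
the measure, as the tents form a generating π-system.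
-/

section StrictConvexity

theorem strictConvexOn_norm_rpow {E : Type*} [NormedAddCommGroup E] [NormedSpace ℝ E]
    [StrictConvexSpace ℝ E] {p : ℝ} (hp : 1 < p) :
    StrictConvexOn ℝ Set.univ fun x : E => ‖x‖ ^ p := by
  have hp₀ : 0 < p := zero_lt_one.trans hp
  refine ⟨convex_univ, fun x _ y _ hne a b ha hb hab => ?_⟩
  rcases eq_or_ne ‖x‖ ‖y‖ with hxy | hxy
  · calc ‖a • x + b • y‖ ^ p < ‖x‖ ^ p :=
          Real.rpow_lt_rpow (norm_nonneg _)
            (norm_combo_lt_of_ne le_rfl hxy.ge hne ha hb hab) hp₀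
      _ = a • ‖x‖ ^ p + b • ‖y‖ ^ p := by rw [← hxy, ← add_smul, hab, one_smul]
  · calc ‖a • x + b • y‖ ^ p ≤ (a • ‖x‖ + b • ‖y‖) ^ p := by
          gcongr
          simpa only [norm_smul_of_nonneg ha.le, norm_smul_of_nonneg hb.le, smul_eq_mul]
            using norm_add_le (a • x) (b • y)
      _ < a • ‖x‖ ^ p + b • ‖y‖ ^ p :=
          (strictConvexOn_rpow hp).2 (norm_nonneg x) (norm_nonneg y) hxy ha hb hab

theorem strictConvexOn_lp_norm_rpow {ι : Type*} {E : ι → Type*} [∀ i, NormedAddCommGroup (E i)]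
    [∀ i, NormedSpace ℝ (E i)] [∀ i, StrictConvexSpace ℝ (E i)] {p : ℝ≥0∞} (hp : 1 < p.toReal) :
    StrictConvexOn ℝ Set.univ fun f : lp E p => ‖f‖ ^ p.toReal := by
  have hp₀ : 0 < p.toReal := zero_lt_one.trans hp
  have hsum (f : lp E p) : Summable fun i => ‖f i‖ ^ p.toReal := (lp.memℓp f).summable hp₀
  refine ⟨convex_univ, fun f _ g _ hne a b ha hb hab => ?_⟩
  obtain ⟨i, hi⟩ : ∃ i, f i ≠ g i := Function.ne_iff.1 (mt (fun h => lp.ext h) hne)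
  have hconv (j : ι) := strictConvexOn_norm_rpow (E := E j) hp
  simp only [lp.norm_rpow_eq_tsum hp₀, smul_eq_mul]
  rw [← tsum_mul_left, ← tsum_mul_left,
    ← ((hsum f).mul_left a).tsum_add ((hsum g).mul_left b)]
  exact Summable.tsum_lt_tsum
    (fun j => (hconv j).convexOn.2 (Set.mem_univ (f j)) (Set.mem_univ (g j)) ha.le hb.le hab)
    ((hconv i).2 (Set.mem_univ (f i)) (Set.mem_univ (g i)) hi ha hb hab)
    (hsum _) (((hsum f).mul_left a).add ((hsum g).mul_left b))

end StrictConvexity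

theorem ennreal_tsum_mul_le_Lp_mul_Lq {ι : Type*} {p q : ℝ} (hpq : p.HolderConjugate q)
    (f g : ι → ℝ≥0∞) :
    ∑' i, f i * g i ≤ (∑' i, f i ^ p) ^ (1 / p) * (∑' i, g i ^ q) ^ (1 / q) := by
  let _ : MeasurableSpace ι := ⊤
  simpa only [lintegral_count, Pi.mul_apply] using
    ENNReal.lintegral_mul_le_Lp_mul_Lq (Measure.count : Measure ι) hpq
      (f := f) (g := g) measurable_from_top.aemeasurable measurable_from_top.aemeasurable

namespace RootEdgeTree

variable {V : Type*} {T : RootEdgeTree V}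

section Edges

theorem eq_of_adj_of_dist_eq {x y z : V} (hx : T.graph.Adj x z) (hy : T.graph.Adj y z)
    (hxz : T.graph.dist T.root z = T.graph.dist T.root x + 1)
    (hyz : T.graph.dist T.root z = T.graph.dist T.root y + 1) : x = y := by
  obtain ⟨p, -, hp⟩ := T.isTree.connected.exists_path_of_dist T.root x
  obtain ⟨q, -, hq⟩ := T.isTree.connected.exists_path_of_dist T.root y
  have hpx : (p.concat hx).IsPath := SimpleGraph.Walk.isPath_of_length_eq_dist _ (by simp; omega)
  have hqy : (q.concat hy).IsPath := SimpleGraph.Walk.isPath_of_length_eq_dist _ (by simp; omega)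
  simpa using congrArg SimpleGraph.Walk.penultimate
    ((T.isTree.existsUnique_path T.root z).unique hpx hqy)

theorem Edge.e_injective : Function.Injective (Edge.e : T.Edge → V) := by
  intro α β h
  exact Edge.ext (eq_of_adj_of_dist_eq α.adj (h ▸ β.adj) α.dist_eq (h ▸ β.dist_eq)) h

theorem exists_edge_e_eq {x : V} (hx : x ≠ T.root) : ∃ α : T.Edge, α.e = x := by
  obtain ⟨p, -, hp⟩ := T.isTree.connected.exists_path_of_dist T.root x
  have hnil : ¬ p.Nil := fun h => hx h.eq.symm
  have hadj := p.adj_penultimate hnil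
  refine ⟨⟨p.penultimate, x, hadj, ?_⟩, rfl⟩
  have hle : T.graph.dist T.root p.penultimate ≤ p.dropLast.length := SimpleGraph.dist_le _
  have hlen : p.dropLast.length + 1 = p.length := SimpleGraph.Walk.length_dropLast_add_one hnil
  rcases T.isTree.dist_eq_dist_add_one_of_adj T.root hadj with h | h <;> omega

variable (T) in
/-- The root edge `ω`. -/
noncomputable def rootEdge : T.Edge where
  b := T.root
  e := T.root_adj.exists.choose
  adj := T.root_adj.exists.choose_spec
  dist_eq := by simp [SimpleGraph.dist_eq_one_iff_adj.2 T.root_adj.exists.choose_spec]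

@[simp] theorem level_rootEdge : T.level T.rootEdge = 0 := SimpleGraph.dist_self

theorem eq_rootEdge_of_b_eq_root {α : T.Edge} (h : α.b = T.root) : α = T.rootEdge :=
  Edge.ext h (T.root_adj.unique (h ▸ α.adj) T.rootEdge.adj)

theorem eq_rootEdge_of_level_eq_zero {α : T.Edge} (h : T.level α = 0) : α = T.rootEdge :=
  eq_rootEdge_of_b_eq_root (T.isTree.connected.dist_eq_zero_iff.1 h).symm

/-- The edges departing from the ending vertex of `α`. -/
def Edge.children (α : T.Edge) : Set T.Edge := {β | β.b = α.e}

theorem level_of_mem_children {α β : T.Edge} (h : β ∈ α.children) :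
    T.level β = T.level α + 1 := by
  rw [level, show β.b = α.e from h, α.dist_eq, level]

theorem eq_of_mem_children {α β γ : T.Edge} (hα : γ ∈ α.children) (hβ : γ ∈ β.children) : α = β :=
  Edge.e_injective (hα.symm.trans hβ)

theorem exists_mem_children {β : T.Edge} (h : T.level β ≠ 0) : ∃ α : T.Edge, β ∈ α.children := by
  have hb : β.b ≠ T.root := fun hb => h (by rw [level, hb, SimpleGraph.dist_self])
  obtain ⟨α, hα⟩ := exists_edge_e_eq hb
  exact ⟨α, hα.symm⟩

theorem rootEdge_notMem_children (α : T.Edge) : T.rootEdge ∉ α.children := fun h => by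
  simpa using level_of_mem_children h

@[elab_as_elim]
theorem Edge.induction {motive : T.Edge → Prop} (root : motive T.rootEdge)
    (child : ∀ α, ∀ β ∈ α.children, motive α → motive β) (α : T.Edge) : motive α := by
  induction hk : T.level α generalizing α with
  | zero => exact eq_rootEdge_of_level_eq_zero hk ▸ root
  | succ k ih =>
    obtain ⟨β, hβ⟩ := exists_mem_children (β := α) (by omega)
    have := level_of_mem_children hβ
    exact child β α hβ (ih β (by omega))

theorem finite_children (α : T.Edge) : α.children.Finite := by
  refine Set.Finite.of_finite_image ((T.locallyFinite α.e).subset ?_) Edge.e_injective.injOn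
  rintro _ ⟨β, hβ, rfl⟩
  have hb : β.b = α.e := hβ
  exact hb ▸ β.adj

theorem deg_eq_zero_iff {α : T.Edge} : T.deg α = 0 ↔ α.children = ∅ :=
  Set.ncard_eq_zero (finite_children α)

theorem setOf_level_eq_succ (k : ℕ) :
    {β : T.Edge | T.level β = k + 1} = ⋃ α ∈ {α : T.Edge | T.level α = k}, α.children := by
  ext β
  simp only [Set.mem_ofPred_eq, Set.mem_iUnion, exists_prop]
  constructor
  · intro hβ
    obtain ⟨α, hα⟩ := exists_mem_children (β := β) (by omega)
    have := level_of_mem_children hα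
    exact ⟨α, by omega, hα⟩
  · rintro ⟨α, rfl, hβ⟩
    exact level_of_mem_children hβ

theorem finite_setOf_level_eq (k : ℕ) : {α : T.Edge | T.level α = k}.Finite := by
  induction k with
  | zero =>
    exact (Set.finite_singleton T.rootEdge).subset fun α => eq_rootEdge_of_level_eq_zero
  | succ k ih => exact setOf_level_eq_succ (T := T) k ▸ ih.biUnion fun α _ => finite_children α

instance : Countable T.Edge := by
  rw [← Set.countable_univ_iff, ← Set.preimage_univ (f := T.level), ← Set.biUnion_of_singleton
    Set.univ, Set.preimage_iUnion₂]
  exact Set.countable_univ.biUnion fun k _ => (finite_setOf_level_eq k).countable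

theorem levelCard_zero : T.levelCard 0 = 1 := by
  refine Set.ncard_eq_one.2 ⟨T.rootEdge, Set.Subset.antisymm ?_ ?_⟩
  · exact fun α => eq_rootEdge_of_level_eq_zero
  · exact Set.singleton_subset_iff.2 level_rootEdge

theorem levelCard_ne_zero_iff {k : ℕ} : T.levelCard k ≠ 0 ↔ ∃ α : T.Edge, T.level α = k :=
  Nat.pos_iff_ne_zero.symm.trans (Set.ncard_pos (finite_setOf_level_eq k))

theorem levelCard_level_ne_zero (α : T.Edge) : T.levelCard (T.level α) ≠ 0 :=
  levelCard_ne_zero_iff.2 ⟨α, rfl⟩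

theorem levelCard_succ {k d : ℕ} (h : ∀ α : T.Edge, T.level α = k → T.deg α = d) :
    T.levelCard (k + 1) = T.levelCard k * d := by
  classical
  have hfin := finite_setOf_level_eq (T := T) k
  have hunion : {β : T.Edge | T.level β = k + 1} =
      hfin.toFinset.biUnion fun α => (finite_children α).toFinset := by
    simp [setOf_level_eq_succ]
  have hdisj : (hfin.toFinset : Set T.Edge).PairwiseDisjoint
      fun α => (finite_children α).toFinset := fun α _ β _ hne =>
    Finset.disjoint_left.2 fun γ hγα hγβ =>
      hne (eq_of_mem_children ((Set.Finite.mem_toFinset _).1 hγα)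
        ((Set.Finite.mem_toFinset _).1 hγβ))
  rw [levelCard, hunion, Set.ncard_coe_finset, Finset.card_biUnion hdisj,
    Finset.sum_const_nat (m := d), levelCard, Set.ncard_eq_toFinset_card _ hfin]
  intro α hα
  exact (Set.ncard_eq_toFinset_card _ (finite_children α)).symm.trans
    (h α (hfin.mem_toFinset.1 hα))

theorem vertexPred_root : T.vertexPred T.root = ∅ := by
  refine Set.eq_empty_of_forall_notMem ?_
  rintro α ⟨q, hq, hα⟩
  rw [SimpleGraph.Walk.isPath_iff_nil, ← SimpleGraph.Walk.eq_nil_iff_nil] at hq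
  simp [hq] at hα

theorem vertexPred_e (α : T.Edge) : T.vertexPred α.e = insert α (T.vertexPred α.b) := by
  obtain ⟨p, hp, hlen⟩ := T.isTree.connected.exists_path_of_dist T.root α.b
  have hpα : (p.concat α.adj).IsPath :=
    SimpleGraph.Walk.isPath_of_length_eq_dist _ (by simp [hlen, α.dist_eq])
  have mem_iff {x : V} {q : T.graph.Walk T.root x} (hq : q.IsPath) (β : T.Edge) :
      β ∈ T.vertexPred x ↔ s(β.b, β.e) ∈ q.edges :=
    ⟨fun ⟨_, hr, h⟩ => (T.isTree.existsUnique_path _ _).unique hr hq ▸ h, fun h => ⟨q, hq, h⟩⟩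
  have edge_eq_iff (β : T.Edge) : s(β.b, β.e) = s(α.b, α.e) ↔ β = α := by
    refine ⟨fun h => ?_, fun h => h ▸ rfl⟩
    rcases Sym2.eq_iff.1 h with ⟨hb, he⟩ | ⟨hb, he⟩
    · exact Edge.ext hb he
    · have hα := α.dist_eq
      have hβ := β.dist_eq
      rw [hb, he] at hβ
      omega
  ext β
  rw [mem_iff hpα, Set.mem_insert_iff, mem_iff hp, SimpleGraph.Walk.edges_concat,
    List.concat_eq_append, List.mem_append, List.mem_singleton, edge_eq_iff, or_comm]

theorem edgeLE_rootEdge_iff {α : T.Edge} : T.edgeLE α T.rootEdge ↔ α = T.rootEdge := by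
  rw [edgeLE, vertexPred_e, show T.rootEdge.b = T.root from rfl, vertexPred_root,
    Set.mem_insert_iff, Set.mem_empty_iff_false, or_false]

theorem edgeLE_iff_of_mem_children {α β γ : T.Edge} (hβ : β ∈ α.children) :
    T.edgeLE γ β ↔ γ = β ∨ T.edgeLE γ α := by
  rw [edgeLE, vertexPred_e, show β.b = α.e from hβ, Set.mem_insert_iff, edgeLE]

theorem edgeLE_refl (α : T.Edge) : T.edgeLE α α := by
  rw [edgeLE, vertexPred_e]
  exact Set.mem_insert _ _

theorem edgeLE_of_mem_children {α β : T.Edge} (hβ : β ∈ α.children) : T.edgeLE α β :=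
  (edgeLE_iff_of_mem_children hβ).2 (Or.inr (edgeLE_refl α))

theorem rootEdge_edgeLE (α : T.Edge) : T.edgeLE T.rootEdge α := by
  induction α using Edge.induction with
  | root => exact edgeLE_refl _
  | child α β hβ ih => exact (edgeLE_iff_of_mem_children hβ).2 (Or.inr ih)

theorem level_le_of_edgeLE {α β : T.Edge} (h : T.edgeLE α β) : T.level α ≤ T.level β := by
  induction β using Edge.induction with
  | root => rw [edgeLE_rootEdge_iff.1 h]
  | child β γ hγ ih =>
    rcases (edgeLE_iff_of_mem_children hγ).1 h with rfl | h
    · exact le_rfl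
    · exact (ih h).trans (level_of_mem_children hγ ▸ Nat.le_succ _)

theorem edgeLE_of_mem_children_of_edgeLE {α β γ : T.Edge} (hβ : β ∈ α.children)
    (h : T.edgeLE β γ) : T.edgeLE α γ := by
  induction γ using Edge.induction with
  | root => exact absurd (edgeLE_rootEdge_iff.1 h ▸ hβ) (rootEdge_notMem_children α)
  | child γ δ hδ ih =>
    rcases (edgeLE_iff_of_mem_children hδ).1 h with rfl | h
    · exact edgeLE_of_mem_children hβ
    · exact (edgeLE_iff_of_mem_children hδ).2 (Or.inr (ih h))

theorem exists_mem_children_edgeLE {α β : T.Edge} (h : T.edgeLE α β) (hne : α ≠ β) :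
    ∃ γ ∈ α.children, T.edgeLE γ β := by
  induction β using Edge.induction with
  | root => exact absurd (edgeLE_rootEdge_iff.1 h) hne
  | child β δ hδ ih =>
    have hαβ : T.edgeLE α β := ((edgeLE_iff_of_mem_children hδ).1 h).resolve_left hne
    by_cases hβ : α = β
    · exact ⟨δ, hβ ▸ hδ, edgeLE_refl δ⟩
    · obtain ⟨γ, hγ, hγβ⟩ := ih hαβ hβ
      exact ⟨γ, hγ, (edgeLE_iff_of_mem_children hδ).2 (Or.inr hγβ)⟩

theorem injOn_level_setOf_edgeLE (α : T.Edge) : Set.InjOn T.level {β | T.edgeLE β α} := by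
  induction α using Edge.induction with
  | root =>
    exact fun β hβ γ hγ _ => (edgeLE_rootEdge_iff.1 hβ).trans (edgeLE_rootEdge_iff.1 hγ).symm
  | child α δ hδ ih =>
    have hset : {β | T.edgeLE β δ} = insert δ {β | T.edgeLE β α} :=
      Set.ext fun β => edgeLE_iff_of_mem_children hδ
    have hlt : ∀ {β}, T.edgeLE β α → T.level β ≠ T.level δ := fun hβ => by
      have := level_le_of_edgeLE hβ
      have := level_of_mem_children hδ
      omega
    have hδα : δ ∉ {β | T.edgeLE β α} := fun h => hlt h rfl
    rw [hset, Set.injOn_insert hδα]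
    exact ⟨ih, fun ⟨β, hβ, h⟩ => hlt hβ h⟩

theorem isLeaf_iff_children_eq_empty {α : T.Edge} : T.IsLeaf α ↔ α.children = ∅ := by
  constructor
  · refine fun h => Set.eq_empty_of_forall_notMem fun β hβ => ?_
    have := level_of_mem_children hβ
    rw [h β (edgeLE_of_mem_children hβ)] at this
    omega
  · intro h β hαβ
    by_contra hne
    obtain ⟨γ, hγ, -⟩ := exists_mem_children_edgeLE hαβ (Ne.symm hne)
    exact Set.notMem_empty γ (h ▸ hγ)

end Edges

section Branches

/-- A branch is a set of edges which runs down from the root edge, one edge per level, and which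
can stop at a leaf only. Branches are the predecessor sets `P(ζ)`, without the distinction between
the two kinds of boundary points. -/
structure IsBranch (P : Set T.Edge) : Prop where
  root_mem : T.rootEdge ∈ P
  parent_mem : ∀ {α β : T.Edge}, β ∈ P → β ∈ α.children → α ∈ P
  injOn_level : Set.InjOn T.level P
  exists_child_mem : ∀ {α : T.Edge}, α ∈ P → α.children.Nonempty → ∃ β ∈ α.children, β ∈ P

theorem level_of_forall_mem_children {e : ℕ → T.Edge} (he₀ : e 0 = T.rootEdge)
    (he : ∀ n, e (n + 1) ∈ (e n).children) (n : ℕ) : T.level (e n) = n := by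
  induction n with
  | zero => rw [he₀, level_rootEdge]
  | succ n ih => rw [level_of_mem_children (he n), ih]

theorem isBranch_range {e : ℕ → T.Edge} (he₀ : e 0 = T.rootEdge)
    (he : ∀ n, e (n + 1) ∈ (e n).children) : IsBranch (Set.range e) where
  root_mem := ⟨0, he₀⟩
  parent_mem := by
    rintro α _ ⟨_ | n, rfl⟩ hα
    · exact absurd (he₀ ▸ hα) (rootEdge_notMem_children α)
    · exact ⟨n, eq_of_mem_children (he n) hα⟩
  injOn_level := by
    rintro _ ⟨m, rfl⟩ _ ⟨n, rfl⟩ h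
    rw [level_of_forall_mem_children he₀ he, level_of_forall_mem_children he₀ he] at h
    rw [h]
  exists_child_mem := by
    rintro _ ⟨n, rfl⟩ -
    exact ⟨e (n + 1), he n, n + 1, rfl⟩

theorem isBranch_setOf_edgeLE {α : T.Edge} (hα : T.IsLeaf α) : IsBranch {β | T.edgeLE β α} where
  root_mem := rootEdge_edgeLE α
  parent_mem := fun hβ hβγ => edgeLE_of_mem_children_of_edgeLE hβγ hβ
  injOn_level := injOn_level_setOf_edgeLE α
  exists_child_mem := fun {β} hβ hne => by
    refine exists_mem_children_edgeLE hβ ?_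
    rintro rfl
    exact hne.ne_empty (isLeaf_iff_children_eq_empty.1 hα)

theorem dist_ray_succ {x : ℕ → V} (zero : x 0 = T.root) (adj : ∀ n, T.graph.Adj (x n) (x (n + 1)))
    (inj : Function.Injective x) (n : ℕ) :
    T.graph.dist T.root (x (n + 1)) = T.graph.dist T.root (x n) + 1 := by
  induction n with
  | zero =>
    rw [zero, SimpleGraph.dist_self, SimpleGraph.dist_eq_one_iff_adj.2 (zero ▸ adj 0)]
  | succ n ih =>
    refine (T.isTree.dist_eq_dist_add_one_of_adj T.root (adj (n + 1))).resolve_left fun h => ?_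
    have hx : x n = x (n + 2) := eq_of_adj_of_dist_eq (adj n) (adj (n + 1)).symm ih h
    have := inj hx
    omega

theorem isBranch_pred (ζ : T.Boundary) : IsBranch (T.pred ζ) := by
  cases ζ with
  | ray x zero adj inj =>
    let e : ℕ → T.Edge := fun n => ⟨x n, x (n + 1), adj n, dist_ray_succ zero adj inj n⟩
    have hpred : T.pred (.ray x zero adj inj) = Set.range e :=
      Set.ext fun α => exists_congr fun n =>
        ⟨fun h => Edge.ext h.1.symm h.2.symm, fun h => h ▸ ⟨rfl, rfl⟩⟩
    exact hpred ▸ isBranch_range (eq_rootEdge_of_b_eq_root zero) fun n => rfl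
  | leaf α hα => exact isBranch_setOf_edgeLE hα

theorem exists_pred_eq_range {e : ℕ → T.Edge} (he₀ : e 0 = T.rootEdge)
    (he : ∀ n, e (n + 1) ∈ (e n).children) : ∃ ζ, T.pred ζ = Set.range e := by
  have hb (n : ℕ) : (e (n + 1)).b = (e n).e := he n
  refine ⟨.ray (fun n => (e n).b) (congrArg Edge.b he₀) (fun n => hb n ▸ (e n).adj)
    fun m n h => ?_, Set.ext fun α => exists_congr fun n => ?_⟩
  · rw [← level_of_forall_mem_children he₀ he m, ← level_of_forall_mem_children he₀ he n]
    exact congrArg (T.graph.dist T.root) h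
  · simp only [hb]
    exact ⟨fun h => (Edge.ext h.1 h.2).symm, fun h => h ▸ ⟨rfl, rfl⟩⟩

namespace IsBranch

variable {P : Set T.Edge} {α β : T.Edge}

theorem edgeLE_of_level_le (hP : IsBranch P) (hα : α ∈ P) (hβ : β ∈ P)
    (h : T.level β ≤ T.level α) : T.edgeLE β α := by
  induction α using Edge.induction with
  | root =>
    rw [level_rootEdge, Nat.le_zero] at h
    exact edgeLE_rootEdge_iff.2 (eq_rootEdge_of_level_eq_zero h)
  | child α γ hγ ih =>
    rcases h.eq_or_lt with h | h
    · exact hP.injOn_level hβ hα h ▸ edgeLE_refl _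
    · rw [level_of_mem_children hγ, Nat.lt_succ_iff] at h
      exact (edgeLE_iff_of_mem_children hγ).2 (Or.inr (ih (hP.parent_mem hα hγ) h))

theorem mem_of_edgeLE (hP : IsBranch P) (hα : α ∈ P) (h : T.edgeLE β α) : β ∈ P := by
  induction α using Edge.induction with
  | root => exact edgeLE_rootEdge_iff.1 h ▸ hα
  | child α γ hγ ih =>
    rcases (edgeLE_iff_of_mem_children hγ).1 h with rfl | h
    · exact hα
    · exact ih (hP.parent_mem hα hγ) h

theorem eq_setOf_edgeLE (hP : IsBranch P) (hα : α ∈ P) (hleaf : T.IsLeaf α) :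
    P = {β | T.edgeLE β α} := by
  refine Set.Subset.antisymm (fun β hβ => ?_) fun β hβ => hP.mem_of_edgeLE hα hβ
  rcases le_total (T.level β) (T.level α) with h | h
  · exact hP.edgeLE_of_level_le hα hβ h
  · exact hleaf β (hP.edgeLE_of_level_le hβ hα h) ▸ edgeLE_refl α

theorem exists_eq_range (hP : IsBranch P) (hleaf : ∀ α ∈ P, ¬ T.IsLeaf α) :
    ∃ e : ℕ → T.Edge, e 0 = T.rootEdge ∧ (∀ n, e (n + 1) ∈ (e n).children) ∧
      P = Set.range e := by
  have hchild (α : P) : ∃ β : P, β.1 ∈ α.1.children := by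
    have hne : α.1.children.Nonempty := Set.nonempty_iff_ne_empty.2 fun h =>
      hleaf α α.2 (isLeaf_iff_children_eq_empty.2 h)
    obtain ⟨β, hβ, hβP⟩ := hP.exists_child_mem α.2 hne
    exact ⟨⟨β, hβP⟩, hβ⟩
  choose next hnext using hchild
  let e (n : ℕ) : P := next^[n] ⟨T.rootEdge, hP.root_mem⟩
  have he (n : ℕ) : (e (n + 1)).1 ∈ (e n).1.children := by
    simpa only [e, Function.iterate_succ_apply'] using hnext (e n)
  have hlevel (n : ℕ) : T.level (e n) = n :=
    level_of_forall_mem_children (e := fun n => (e n).1) rfl he n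
  refine ⟨fun n => e n, rfl, he, Set.Subset.antisymm (fun α hα => ⟨T.level α, ?_⟩) ?_⟩
  · exact hP.injOn_level (e _).2 hα (hlevel _)
  · rintro _ ⟨n, rfl⟩
    exact (e n).2

theorem exists_pred_eq (hP : IsBranch P) : ∃ ζ, T.pred ζ = P := by
  by_cases hleaf : ∃ α ∈ P, T.IsLeaf α
  · obtain ⟨α, hα, hαleaf⟩ := hleaf
    exact ⟨.leaf α hαleaf, (hP.eq_setOf_edgeLE hα hαleaf).symm⟩
  · obtain ⟨e, he₀, he, rfl⟩ := hP.exists_eq_range fun α hα h => hleaf ⟨α, hα, h⟩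
    exact exists_pred_eq_range he₀ he

theorem exists_level_eq (hP : IsBranch P) (hT : T.IsSphericallySymmetric) {k : ℕ}
    (hk : T.levelCard k ≠ 0) : ∃ α ∈ P, T.level α = k := by
  induction k with
  | zero => exact ⟨T.rootEdge, hP.root_mem, level_rootEdge⟩
  | succ k ih =>
    obtain ⟨β, hβ⟩ := levelCard_ne_zero_iff.1 hk
    obtain ⟨γ, hγ⟩ := exists_mem_children (β := β) (by omega)
    have hγk : T.level γ = k := by
      have := level_of_mem_children hγ
      omega
    obtain ⟨α, hα, hαk⟩ := ih (levelCard_ne_zero_iff.2 ⟨γ, hγk⟩)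
    have hdeg : T.deg α ≠ 0 := by
      rw [hT α γ (hαk.trans hγk.symm), Ne, deg_eq_zero_iff]
      exact Set.nonempty_iff_ne_empty.1 ⟨β, hγ⟩
    obtain ⟨δ, hδ, hδP⟩ :=
      hP.exists_child_mem hα (Set.nonempty_iff_ne_empty.2 (mt deg_eq_zero_iff.2 hdeg))
    exact ⟨δ, hδP, by rw [level_of_mem_children hδ, hαk]⟩

end IsBranch

variable (T) in
/-- The nonempty levels of `T`. -/
abbrev Level : Type := {k : ℕ // T.levelCard k ≠ 0}

/-- The level of an edge, as a nonempty level. -/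
noncomputable def Edge.toLevel (α : T.Edge) : T.Level := ⟨T.level α, levelCard_level_ne_zero α⟩

theorem bijective_toLevel_pred (hT : T.IsSphericallySymmetric) (ζ : T.Boundary) :
    Function.Bijective fun α : T.pred ζ => α.1.toLevel := by
  refine ⟨fun α β h => ?_, fun k => ?_⟩
  · exact Subtype.ext ((isBranch_pred ζ).injOn_level α.2 β.2 (congrArg Subtype.val h))
  · obtain ⟨α, hα, hk⟩ := (isBranch_pred ζ).exists_level_eq hT k.2
    exact ⟨⟨α, hα⟩, Subtype.ext hk⟩

end Branches

section TentBoundaries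

instance : SecondCountableTopology T.Boundary :=
  ⟨⟨Set.range T.tentBoundary, Set.countable_range _, rfl⟩⟩

variable (T) in
theorem measurableSpace_boundary_eq_generateFrom :
    (instMeasurableSpaceBoundary T : MeasurableSpace T.Boundary) =
      MeasurableSpace.generateFrom (Set.range T.tentBoundary) :=
  borel_eq_generateFrom_of_subbasis rfl

theorem measurableSet_tentBoundary (α : T.Edge) : MeasurableSet (T.tentBoundary α) :=
  (TopologicalSpace.isOpen_generateFrom_of_mem (Set.mem_range_self α)).measurableSet

theorem tentBoundary_rootEdge : T.tentBoundary T.rootEdge = Set.univ :=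
  Set.eq_univ_of_forall fun ζ => (isBranch_pred ζ).root_mem

theorem tentBoundary_subset_of_level_le {α β : T.Edge} (h : T.level α ≤ T.level β)
    (hne : (T.tentBoundary α ∩ T.tentBoundary β).Nonempty) :
    T.tentBoundary β ⊆ T.tentBoundary α := by
  obtain ⟨ζ, hα, hβ⟩ := hne
  have hαβ : T.edgeLE α β := (isBranch_pred ζ).edgeLE_of_level_le hβ hα h
  exact fun ξ hξ => (isBranch_pred ξ).mem_of_edgeLE hξ hαβ

variable (T) in
theorem isPiSystem_range_tentBoundary : IsPiSystem (Set.range T.tentBoundary) := by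
  rintro _ ⟨α, rfl⟩ _ ⟨β, rfl⟩ hne
  rcases le_total (T.level α) (T.level β) with h | h
  · rw [Set.inter_eq_right.2 (tentBoundary_subset_of_level_le h hne)]
    exact ⟨β, rfl⟩
  · rw [Set.inter_comm] at hne
    rw [Set.inter_eq_left.2 (tentBoundary_subset_of_level_le h hne)]
    exact ⟨α, rfl⟩

theorem measure_ext_of_copotential {μ ν : Measure T.Boundary} [IsFiniteMeasure μ]
    [IsFiniteMeasure ν] (h : T.copotential μ = T.copotential ν) : μ = ν := by
  have htent (α : T.Edge) : μ (T.tentBoundary α) = ν (T.tentBoundary α) :=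
    (measureReal_eq_measureReal_iff).1 (congrFun h α)
  refine ext_of_generate_finite _ (measurableSpace_boundary_eq_generateFrom T)
    (isPiSystem_range_tentBoundary T) (Set.forall_mem_range.2 htent) ?_
  simpa only [tentBoundary_rootEdge] using htent T.rootEdge

end TentBoundaries

section VisibilityMeasure

instance : MeasurableSpace T.Edge := ⊤

instance : DiscreteMeasurableSpace T.Edge := ⟨fun _ => trivial⟩

instance (α : T.Edge) : Finite α.children := finite_children α

variable (T) in
/-- The edges which are not leaves. -/
abbrev InnerEdge : Type _ := {α : T.Edge // α.children.Nonempty}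

instance (α : T.InnerEdge) : Nonempty α.1.children := α.2.to_subtype

variable (T) in
/-- A choice of a child of every edge that has one. -/
abbrev Selection : Type _ := ∀ α : T.InnerEdge, α.1.children

/-- The edges traversed by the descent from the root edge that follows the selection `s`. -/
inductive IsSelected (s : T.Selection) : T.Edge → Prop
  | root : IsSelected s T.rootEdge
  | child (α : T.InnerEdge) : IsSelected s α → IsSelected s (s α)

theorem isSelected_iff_of_mem_children {s : T.Selection} {α β : T.Edge} (hβ : β ∈ α.children) :
    IsSelected s β ↔ IsSelected s α ∧ s ⟨α, β, hβ⟩ = ⟨β, hβ⟩ := by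
  constructor
  · rintro (_ | ⟨γ, hγ⟩)
    · exact absurd hβ (rootEdge_notMem_children α)
    · obtain rfl : α = γ := eq_of_mem_children hβ (s γ).2
      exact ⟨hγ, rfl⟩
  · rintro ⟨hα, hs⟩
    simpa only [hs] using IsSelected.child ⟨α, β, hβ⟩ hα

theorem isBranch_setOf_isSelected (s : T.Selection) : IsBranch {α | IsSelected s α} where
  root_mem := .root
  parent_mem := fun hβ h => ((isSelected_iff_of_mem_children h).1 hβ).1
  injOn_level := by
    intro α hα β hβ h
    induction α using Edge.induction generalizing β with
    | root => exact (eq_rootEdge_of_level_eq_zero (h.symm.trans level_rootEdge)).symm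
    | child γ α hγ ih =>
      have hα' := (isSelected_iff_of_mem_children hγ).1 hα
      have hlevel := level_of_mem_children hγ
      obtain ⟨δ, hδ⟩ := exists_mem_children (β := β) (by omega)
      have hβ' := (isSelected_iff_of_mem_children hδ).1 hβ
      obtain rfl : γ = δ := ih hα'.1 hβ'.1 (by have := level_of_mem_children hδ; omega)
      exact congrArg Subtype.val (hα'.2.symm.trans hβ'.2)
  exists_child_mem := fun {α} hα hne => ⟨s ⟨α, hne⟩, (s ⟨α, hne⟩).2, .child ⟨α, hne⟩ hα⟩

/-- The boundary point reached by the descent that follows the selection `s`. -/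
noncomputable def selectionLimit (s : T.Selection) : T.Boundary :=
  (isBranch_setOf_isSelected s).exists_pred_eq.choose

theorem preimage_selectionLimit_tentBoundary (α : T.Edge) :
    selectionLimit ⁻¹' T.tentBoundary α = {s | IsSelected s α} :=
  Set.ext fun s =>
    Set.ext_iff.1 (isBranch_setOf_isSelected s).exists_pred_eq.choose_spec α

theorem setOf_isSelected_eq_pi_insert {α β : T.Edge} (hβ : β ∈ α.children)
    {F : Finset T.InnerEdge} {t : ∀ γ : T.InnerEdge, Set γ.1.children}
    [DecidableEq T.InnerEdge] (hαF : ⟨α, β, hβ⟩ ∉ F)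
    (hα : {s | IsSelected s α} = Set.pi F t) :
    {s | IsSelected s β} =
      Set.pi ↑(insert ⟨α, β, hβ⟩ F) (Function.update t ⟨α, β, hβ⟩ {⟨β, hβ⟩}) := by
  have hpi : Set.pi F (Function.update t ⟨α, β, hβ⟩ {⟨β, hβ⟩}) = Set.pi F t :=
    Set.pi_congr rfl fun γ hγ => Function.update_of_ne (ne_of_mem_of_not_mem hγ hαF) _ _
  rw [Finset.coe_insert, Set.insert_pi, Function.update_self, hpi, ← hα]
  exact Set.ext fun s => (isSelected_iff_of_mem_children hβ).trans and_comm

theorem exists_setOf_isSelected_eq_pi (α : T.Edge) :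
    ∃ (F : Finset T.InnerEdge) (t : ∀ γ : T.InnerEdge, Set γ.1.children),
      (∀ γ ∈ F, T.level γ < T.level α) ∧ {s | IsSelected s α} = Set.pi F t := by
  classical
  induction α using Edge.induction with
  | root => exact ⟨∅, fun _ => ∅, by simp, by simp [IsSelected.root]⟩
  | child α β hβ ih =>
    obtain ⟨F, t, hF, hα⟩ := ih
    have hlevel := level_of_mem_children hβ
    refine ⟨_, _, ?_, setOf_isSelected_eq_pi_insert hβ (fun h => (hF _ h).ne rfl) hα⟩
    simp only [Finset.forall_mem_insert]
    exact ⟨by omega, fun γ hγ => (hF γ hγ).trans (by omega)⟩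

theorem measurable_selectionLimit : Measurable (selectionLimit : T.Selection → T.Boundary) := by
  rw [measurableSpace_boundary_eq_generateFrom T]
  refine measurable_generateFrom (Set.forall_mem_range.2 fun α => ?_)
  obtain ⟨F, t, -, hα⟩ := exists_setOf_isSelected_eq_pi α
  rw [preimage_selectionLimit_tentBoundary, hα]
  exact MeasurableSet.pi F.countable_toSet fun γ _ => MeasurableSet.of_discrete

/-- The uniform distribution on the children of an edge. -/
noncomputable def uniformChild (α : T.InnerEdge) : Measure α.1.children :=
  ProbabilityTheory.uniformOn Set.univ

instance (α : T.InnerEdge) : IsProbabilityMeasure (uniformChild α) :=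
  ProbabilityTheory.isProbabilityMeasure_uniformOn Set.finite_univ Set.univ_nonempty

theorem uniformChild_singleton (α : T.InnerEdge) (β : α.1.children) :
    uniformChild α {β} = (T.deg α : ℝ≥0∞)⁻¹ := by
  have := Fintype.ofFinite α.1.children
  rw [uniformChild, ProbabilityTheory.uniformOn_univ, Measure.count_singleton, one_div,
    ← Nat.card_eq_fintype_card, Nat.card_coe_set_eq, deg, Edge.children]

variable (T) in
/-- The visibility measure: the law of the boundary point reached by descending from the root edge
and choosing, independently at each step, a uniformly distributed child. -/
noncomputable def visibilityMeasure : Measure T.Boundary :=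
  (Measure.infinitePi uniformChild).map selectionLimit

instance : IsProbabilityMeasure T.visibilityMeasure :=
  Measure.isProbabilityMeasure_map measurable_selectionLimit.aemeasurable

theorem visibilityMeasure_tentBoundary_eq_prod {α : T.Edge} {F : Finset T.InnerEdge}
    {t : ∀ γ : T.InnerEdge, Set γ.1.children} (h : {s | IsSelected s α} = Set.pi F t) :
    T.visibilityMeasure (T.tentBoundary α) = ∏ γ ∈ F, uniformChild γ (t γ) := by
  rw [visibilityMeasure, Measure.map_apply measurable_selectionLimit (measurableSet_tentBoundary α),
    preimage_selectionLimit_tentBoundary, h,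
    Measure.infinitePi_pi _ fun γ _ => MeasurableSet.of_discrete]

theorem visibilityMeasure_tentBoundary_of_mem_children {α β : T.Edge} (hβ : β ∈ α.children) :
    T.visibilityMeasure (T.tentBoundary β) =
      (T.deg α : ℝ≥0∞)⁻¹ * T.visibilityMeasure (T.tentBoundary α) := by
  classical
  obtain ⟨F, t, hF, hα⟩ := exists_setOf_isSelected_eq_pi α
  have hαF : ⟨α, β, hβ⟩ ∉ F := fun h => (hF _ h).ne rfl
  rw [visibilityMeasure_tentBoundary_eq_prod hα,
    visibilityMeasure_tentBoundary_eq_prod (setOf_isSelected_eq_pi_insert hβ hαF hα),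
    Finset.prod_insert hαF, Function.update_self, uniformChild_singleton]
  congr 1
  exact Finset.prod_congr rfl fun γ hγ => by
    rw [Function.update_of_ne (ne_of_mem_of_not_mem hγ hαF)]

theorem visibilityMeasure_tentBoundary (hT : T.IsSphericallySymmetric) (α : T.Edge) :
    T.visibilityMeasure (T.tentBoundary α) = (T.levelCard (T.level α) : ℝ≥0∞)⁻¹ := by
  induction α using Edge.induction with
  | root => simp [tentBoundary_rootEdge, levelCard_zero]
  | child α β hβ ih =>
    rw [visibilityMeasure_tentBoundary_of_mem_children hβ, ih, level_of_mem_children hβ,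
      levelCard_succ fun γ hγ => hT γ α hγ, Nat.cast_mul, mul_comm,
      ENNReal.mul_inv (by simp) (by simp)]

end VisibilityMeasure

section Capacity

variable {p : ℝ} {E : Set T.Boundary}

theorem convex_testFunctions : Convex ℝ (T.testFunctions p E) := by
  intro f hf g hg a b ha hb hab
  refine ⟨fun α => add_nonneg (mul_nonneg ha (hf.1 α)) (mul_nonneg hb (hg.1 α)), fun ζ hζ => ?_⟩
  calc (1 : ℝ≥0∞) = ENNReal.ofReal a * 1 + ENNReal.ofReal b * 1 := by
        rw [mul_one, mul_one, ← ENNReal.ofReal_add ha hb, hab, ENNReal.ofReal_one]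
    _ ≤ ENNReal.ofReal a * T.potential f ζ + ENNReal.ofReal b * T.potential g ζ := by
        gcongr
        exacts [hf.2 ζ hζ, hg.2 ζ hζ]
    _ = T.potential (a • f + b • g) ζ := by
        rw [potential, potential, potential, ← ENNReal.tsum_mul_left, ← ENNReal.tsum_mul_left,
          ← ENNReal.tsum_add]
        refine tsum_congr fun α => ?_
        rw [← ENNReal.ofReal_mul ha, ← ENNReal.ofReal_mul hb,
          ← ENNReal.ofReal_add (mul_nonneg ha (hf.1 _)) (mul_nonneg hb (hg.1 _))]
        rfl

variable [hp : Fact (1 < p)]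

theorem ofReal_norm_rpow (f : T.EdgeLp p) :
    ENNReal.ofReal (‖f‖ ^ p) = ∑' α, ENNReal.ofReal |f α| ^ p := by
  have hp₀ : 0 < p := zero_lt_one.trans hp.out
  have hp' : (ENNReal.ofReal p).toReal = p := ENNReal.toReal_ofReal hp₀.le
  have hnorm := lp.norm_rpow_eq_tsum (hp'.symm ▸ hp₀) f
  have hsum := (lp.memℓp f).summable (hp'.symm ▸ hp₀)
  simp only [hp', Real.norm_eq_abs] at hnorm hsum
  rw [hnorm, ENNReal.ofReal_tsum_of_nonneg (fun α => by positivity) hsum]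
  exact tsum_congr fun α => (ENNReal.ofReal_rpow_of_nonneg (abs_nonneg _) hp₀.le).symm

theorem ofReal_norm_rpow_of_nonneg {f : T.EdgeLp p} (hf : ∀ α, 0 ≤ f α) :
    ENNReal.ofReal (‖f‖ ^ p) = ∑' α, ENNReal.ofReal (f α) ^ p := by
  simp only [ofReal_norm_rpow, abs_of_nonneg (hf _)]

theorem capacity_le_of_mem_closure {f : T.EdgeLp p} (hf : f ∈ closure (T.testFunctions p E)) :
    T.capacity p E ≤ ENNReal.ofReal (‖f‖ ^ p) := by
  have hp₀ : 0 ≤ p := zero_le_one.trans hp.out.le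
  have hsub : T.testFunctions p E ⊆ {f | T.capacity p E ≤ ENNReal.ofReal (‖f‖ ^ p)} :=
    fun g hg => iInf₂_le (f := fun g _ => ENNReal.ofReal (‖g‖ ^ p)) g hg
  have hclosed : IsClosed {f : T.EdgeLp p | T.capacity p E ≤ ENNReal.ofReal (‖f‖ ^ p)} :=
    isClosed_le continuous_const
      (ENNReal.continuous_ofReal.comp (continuous_norm.rpow_const fun _ => Or.inr hp₀))
  exact closure_minimal hsub hclosed hf

theorem zero_mem_closure_testFunctions (h : T.capacity p E = 0) :
    (0 : T.EdgeLp p) ∈ closure (T.testFunctions p E) := by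
  refine Metric.mem_closure_iff.2 fun ε hε => ?_
  have hlt : T.capacity p E < ENNReal.ofReal (ε ^ p) := by
    rw [h, ENNReal.ofReal_pos]
    positivity
  simp only [capacity, iInf_lt_iff] at hlt
  obtain ⟨f, hf, hfε⟩ := hlt
  refine ⟨f, hf, ?_⟩
  rw [ENNReal.ofReal_lt_ofReal_iff (by positivity)] at hfε
  rw [dist_zero_left]
  exact (Real.rpow_lt_rpow_iff (norm_nonneg f) hε.le (zero_lt_one.trans hp.out)).1 hfε

theorem IsEquilibriumFunction.isMinOn {f : T.EdgeLp p} (hf : T.IsEquilibriumFunction p E f) :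
    IsMinOn (fun g : T.EdgeLp p => ‖g‖ ^ p) (closure (T.testFunctions p E)) f := fun g hg => by
  have hle : ENNReal.ofReal (‖f‖ ^ p) ≤ ENNReal.ofReal (‖g‖ ^ p) :=
    hf.2.trans_le (capacity_le_of_mem_closure hg)
  exact (ENNReal.ofReal_le_ofReal_iff (by positivity)).1 hle

theorem IsEquilibriumFunction.eq {f g : T.EdgeLp p} (hf : T.IsEquilibriumFunction p E f)
    (hg : T.IsEquilibriumFunction p E g) : f = g := by
  have hp' : (ENNReal.ofReal p).toReal = p := ENNReal.toReal_ofReal (zero_le_one.trans hp.out.le)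
  have hconv := strictConvexOn_lp_norm_rpow (E := fun _ : T.Edge => ℝ) (p := ENNReal.ofReal p)
    (hp'.symm ▸ hp.out)
  simp only [hp'] at hconv
  exact (hconv.subset (Set.subset_univ _) convex_testFunctions.closure).eq_of_isMinOn
    hf.isMinOn hg.isMinOn hf.1 hg.1

theorem conjExponent_sub_one_pos : 0 < p.conjExponent - 1 :=
  (Real.HolderConjugate.conjExponent hp.out).symm.sub_one_pos

theorem IsEquilibriumMeasure.eq {μ ν : Measure T.Boundary} (hμ : T.IsEquilibriumMeasure p E μ)
    (hν : T.IsEquilibriumMeasure p E ν) : μ = ν := by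
  have := hμ.finite
  have := hν.finite
  obtain ⟨f, hfμ, hf⟩ := hμ.equilibrium
  obtain ⟨g, hgν, hg⟩ := hν.equilibrium
  refine measure_ext_of_copotential (funext fun α => ?_)
  have hpow : T.copotential μ α ^ (p.conjExponent - 1) =
      T.copotential ν α ^ (p.conjExponent - 1) := by rw [← hfμ, ← hgν, hf.eq hg]
  exact (Real.rpow_left_inj measureReal_nonneg measureReal_nonneg
    conjExponent_sub_one_pos.ne').1 hpow

theorem isEquilibriumMeasure_zero (h : T.capacity p E = 0) : T.IsEquilibriumMeasure p E 0 where
  finite := inferInstance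
  support := by simp
  mass := by simp [h]
  equilibrium := by
    have hp₀ : p ≠ 0 := (zero_lt_one.trans hp.out).ne'
    refine ⟨0, fun α => ?_, zero_mem_closure_testFunctions h, ?_⟩
    · simp [copotential, Real.zero_rpow conjExponent_sub_one_pos.ne']
    · simp [h, Real.zero_rpow hp₀]

end Capacity

section Duality

theorem potential_eq_tsum_indicator (f : T.Edge → ℝ) (ζ : T.Boundary) :
    T.potential f ζ =
      ∑' α, (T.tentBoundary α).indicator (fun _ => ENNReal.ofReal (f α)) ζ :=
  tsum_subtype (T.pred ζ) fun α => ENNReal.ofReal (f α)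

theorem measurable_potential (f : T.Edge → ℝ) : Measurable (T.potential f) := by
  simp only [funext (potential_eq_tsum_indicator f)]
  exact .tsum fun α => measurable_const.indicator (measurableSet_tentBoundary α)

theorem lintegral_potential (f : T.Edge → ℝ) (μ : Measure T.Boundary) :
    ∫⁻ ζ, T.potential f ζ ∂μ = ∑' α, ENNReal.ofReal (f α) * μ (T.tentBoundary α) := by
  simp only [potential_eq_tsum_indicator]
  rw [lintegral_tsum fun α =>
    (measurable_const.indicator (measurableSet_tentBoundary α)).aemeasurable]
  simp only [lintegral_indicator_const (measurableSet_tentBoundary _)]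

/-- The energy `∑ M(α) ^ p'` of a measure with co-potential `M`. -/
noncomputable def energy (p : ℝ) (μ : Measure T.Boundary) : ℝ≥0∞ :=
  ∑' α, μ (T.tentBoundary α) ^ p.conjExponent

variable {p : ℝ} [hp : Fact (1 < p)] {E : Set T.Boundary}

theorem measure_rpow_le_norm_rpow_mul_energy_rpow (μ : Measure T.Boundary) {f : T.EdgeLp p}
    (hf : f ∈ T.testFunctions p E) :
    μ E ^ p ≤ ENNReal.ofReal (‖f‖ ^ p) * energy p μ ^ (p - 1) := by
  have hpq := Real.HolderConjugate.conjExponent hp.out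
  have hp₀ : 0 < p := hpq.pos
  have hexp : 1 / p.conjExponent * p = p - 1 := by
    rw [Real.conjExponent]
    field_simp
  have hμ : μ E ≤ ENNReal.ofReal (‖f‖ ^ p) ^ (1 / p) * energy p μ ^ (1 / p.conjExponent) :=
    calc μ E ≤ ∫⁻ ζ, T.potential f ζ ∂μ :=
          meas_le_lintegral₀ (measurable_potential f).aemeasurable hf.2
      _ = ∑' α, ENNReal.ofReal (f α) * μ (T.tentBoundary α) := lintegral_potential f μ
      _ ≤ _ := by
          rw [ofReal_norm_rpow_of_nonneg hf.1]
          exact ennreal_tsum_mul_le_Lp_mul_Lq hpq _ _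
  calc μ E ^ p
    _ ≤ (ENNReal.ofReal (‖f‖ ^ p) ^ (1 / p) * energy p μ ^ (1 / p.conjExponent)) ^ p := by gcongr
    _ = ENNReal.ofReal (‖f‖ ^ p) * energy p μ ^ (p - 1) := by
        rw [ENNReal.mul_rpow_of_nonneg _ _ hp₀.le, ← ENNReal.rpow_mul, ← ENNReal.rpow_mul,
          one_div_mul_cancel hp₀.ne', ENNReal.rpow_one, hexp]

theorem measure_rpow_div_energy_rpow_le_capacity (μ : Measure T.Boundary) :
    μ E ^ p / energy p μ ^ (p - 1) ≤ T.capacity p E :=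
  le_iInf₂ fun _ hf => ENNReal.div_le_of_le_mul (measure_rpow_le_norm_rpow_mul_energy_rpow μ hf)

end Duality

section SphericallySymmetric

theorem tsum_toLevel (g : T.Level → ℝ≥0∞) :
    ∑' α : T.Edge, g α.toLevel = ∑' k : T.Level, (T.levelCard k : ℝ≥0∞) * g k := by
  rw [← ENNReal.tsum_fiberwise (fun α : T.Edge => g α.toLevel) Edge.toLevel]
  refine tsum_congr fun k => ?_
  have hfiber : Edge.toLevel ⁻¹' {k} = {α : T.Edge | T.level α = k} :=
    Set.ext fun α => Subtype.ext_iff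
  have hconst (α : Edge.toLevel ⁻¹' {k}) : g α.1.toLevel = g k := congrArg g α.2
  rw [tsum_congr hconst, ENNReal.tsum_set_const, hfiber, levelCard,
    ← (finite_setOf_level_eq k.1).cast_ncard_eq, ENat.toENNReal_coe]

theorem potential_toLevel (hT : T.IsSphericallySymmetric) {f : T.Edge → ℝ} {g : T.Level → ℝ≥0∞}
    (hf : ∀ α, ENNReal.ofReal (f α) = g α.toLevel) (ζ : T.Boundary) :
    T.potential f ζ = ∑' k, g k := by
  rw [potential, ← (Equiv.ofBijective _ (bijective_toLevel_pred hT ζ)).tsum_eq]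
  exact tsum_congr fun α => hf α

variable (T) in
/-- The term `N_k ^ (1 - p')` of the series which determines the capacity of the boundary. -/
noncomputable def levelWeight (p : ℝ) (k : T.Level) : ℝ≥0∞ :=
  (T.levelCard k : ℝ≥0∞) ^ (1 - p.conjExponent)

variable {p : ℝ}

theorem coe_levelCard_ne_zero (k : T.Level) : (T.levelCard k : ℝ≥0∞) ≠ 0 :=
  Nat.cast_ne_zero.2 k.2

theorem levelWeight_ne_top (k : T.Level) : T.levelWeight p k ≠ ∞ :=
  ENNReal.rpow_ne_top_of_ne_zero (coe_levelCard_ne_zero k) (ENNReal.natCast_ne_top _)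

theorem one_le_tsum_levelWeight : 1 ≤ ∑' k, T.levelWeight p k := by
  have hroot : T.levelWeight p T.rootEdge.toLevel = 1 := by
    simp [levelWeight, Edge.toLevel, levelCard_zero]
  exact hroot ▸ ENNReal.le_tsum T.rootEdge.toLevel

theorem tsum_levelWeight_ne_zero : ∑' k, T.levelWeight p k ≠ 0 :=
  (zero_lt_one.trans_le one_le_tsum_levelWeight).ne'

theorem energy_visibilityMeasure (hT : T.IsSphericallySymmetric) :
    energy p T.visibilityMeasure = ∑' k, T.levelWeight p k := by
  simp only [energy, visibilityMeasure_tentBoundary hT]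
  refine (tsum_toLevel fun k => (T.levelCard k : ℝ≥0∞)⁻¹ ^ p.conjExponent).trans
    (tsum_congr fun k => ?_)
  rw [levelWeight, ENNReal.rpow_sub _ _ (coe_levelCard_ne_zero k) (ENNReal.natCast_ne_top _),
    ENNReal.rpow_one, ENNReal.inv_rpow, div_eq_mul_inv]

variable [hp : Fact (1 < p)]

theorem levelCard_mul_levelWeight_rpow (k : T.Level) :
    (T.levelCard k : ℝ≥0∞) * T.levelWeight p k ^ p = T.levelWeight p k := by
  have hexp : 1 + (1 - p.conjExponent) * p = 1 - p.conjExponent := by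
    linarith [(Real.HolderConjugate.conjExponent hp.out).mul_eq_add]
  rw [levelWeight, ← ENNReal.rpow_mul]
  nth_rewrite 1 [← ENNReal.rpow_one (T.levelCard k : ℝ≥0∞)]
  rw [← ENNReal.rpow_add _ _ (coe_levelCard_ne_zero k) (ENNReal.natCast_ne_top _), hexp]

theorem exists_testFunction_toLevel (hT : T.IsSphericallySymmetric) {g : T.Level → ℝ≥0∞}
    (hg : 1 ≤ ∑' k, g k) (hg' : ∑' k : T.Level, (T.levelCard k : ℝ≥0∞) * g k ^ p ≠ ∞) :
    ∃ f ∈ T.testFunctions p Set.univ, (∀ α, f α = (g α.toLevel).toReal) ∧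
      ENNReal.ofReal (‖f‖ ^ p) = ∑' k : T.Level, (T.levelCard k : ℝ≥0∞) * g k ^ p := by
  have hp₀ : 0 < p := zero_lt_one.trans hp.out
  have hgtop (k : T.Level) : g k ≠ ∞ := fun hk => ENNReal.ne_top_of_tsum_ne_top hg' k <| by
    rw [hk, ENNReal.top_rpow_of_pos hp₀, ENNReal.mul_top (coe_levelCard_ne_zero k)]
  rw [← tsum_toLevel fun k => g k ^ p] at hg' ⊢
  have hmem : Memℓp (fun α : T.Edge => (g α.toLevel).toReal) (ENNReal.ofReal p) := by
    refine memℓp_gen ((ENNReal.summable_toReal hg').congr fun α => ?_)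
    rw [ENNReal.toReal_ofReal hp₀.le, Real.norm_of_nonneg ENNReal.toReal_nonneg,
      ENNReal.toReal_rpow]
  have hnonneg (α : T.Edge) : 0 ≤ (g α.toLevel).toReal := ENNReal.toReal_nonneg
  have hofReal (α : T.Edge) : ENNReal.ofReal (g α.toLevel).toReal = g α.toLevel :=
    ENNReal.ofReal_toReal (hgtop _)
  refine ⟨⟨_, hmem⟩, ⟨hnonneg, fun ζ _ => ?_⟩, fun α => rfl, ?_⟩
  · exact hg.trans_eq (potential_toLevel hT hofReal ζ).symm
  · exact (ofReal_norm_rpow_of_nonneg hnonneg).trans (tsum_congr fun α => by rw [hofReal])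

theorem exists_testFunction_of_levelCard_mul_rpow_eq (hT : T.IsSphericallySymmetric)
    {u : T.Level → ℝ≥0∞} (hu : ∀ k : T.Level, (T.levelCard k : ℝ≥0∞) * u k ^ p = u k)
    (h₀ : ∑' k, u k ≠ 0) (h_top : ∑' k, u k ≠ ∞) :
    ∃ f ∈ T.testFunctions p Set.univ, (∀ α, f α = ((∑' k, u k)⁻¹ * u α.toLevel).toReal) ∧
      ENNReal.ofReal (‖f‖ ^ p) = (∑' k, u k) ^ (1 - p) := by
  set S := ∑' k, u k
  have hsum : ∑' k, S⁻¹ * u k = 1 := by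
    rw [ENNReal.tsum_mul_left, ENNReal.inv_mul_cancel h₀ h_top]
  have hpow : ∑' k : T.Level, (T.levelCard k : ℝ≥0∞) * (S⁻¹ * u k) ^ p = S ^ (1 - p) :=
    calc ∑' k : T.Level, (T.levelCard k : ℝ≥0∞) * (S⁻¹ * u k) ^ p
      _ = ∑' k, S ^ (-p) * u k := tsum_congr fun k => by
          rw [ENNReal.mul_rpow_of_nonneg _ _ (zero_le_one.trans hp.out.le), mul_left_comm, hu,
            ENNReal.inv_rpow, ENNReal.rpow_neg]
      _ = S ^ (-p) * S ^ (1 : ℝ) := by rw [ENNReal.tsum_mul_left, ENNReal.rpow_one]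
      _ = S ^ (1 - p) := by rw [← ENNReal.rpow_add _ _ h₀ h_top, neg_add_eq_sub]
  rw [← hpow]
  exact exists_testFunction_toLevel hT hsum.ge
    (hpow ▸ ENNReal.rpow_ne_top_of_ne_zero h₀ h_top)

theorem capacity_univ_le_sum_rpow (hT : T.IsSphericallySymmetric) (s : Finset T.Level) :
    T.capacity p Set.univ ≤ (∑ k ∈ s, T.levelWeight p k) ^ (1 - p) := by
  rcases eq_or_ne (∑ k ∈ s, T.levelWeight p k) 0 with h₀ | h₀
  · rw [h₀, ENNReal.zero_rpow_of_neg (sub_neg.2 hp.out)]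
    exact le_top
  have h_top : ∑ k ∈ s, T.levelWeight p k ≠ ∞ :=
    ENNReal.sum_ne_top.2 fun k _ => levelWeight_ne_top k
  rw [sum_eq_tsum_indicator] at h₀ h_top ⊢
  have hu (k : T.Level) : (T.levelCard k : ℝ≥0∞) *
      (s : Set T.Level).indicator (T.levelWeight p) k ^ p =
        (s : Set T.Level).indicator (T.levelWeight p) k := by
    by_cases hk : k ∈ (s : Set T.Level)
    · rw [Set.indicator_of_mem hk, levelCard_mul_levelWeight_rpow]
    · rw [Set.indicator_of_notMem hk, ENNReal.zero_rpow_of_pos (zero_lt_one.trans hp.out),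
        mul_zero]
  obtain ⟨f, hf, -, hnorm⟩ := exists_testFunction_of_levelCard_mul_rpow_eq hT hu h₀ h_top
  exact hnorm ▸ iInf₂_le f hf

theorem capacity_univ (hT : T.IsSphericallySymmetric) :
    T.capacity p Set.univ = (∑' k, T.levelWeight p k) ^ (1 - p) := by
  refine le_antisymm ?_ ?_
  · have hlim : Filter.Tendsto (fun s : Finset T.Level => (∑ k ∈ s, T.levelWeight p k) ^ (1 - p))
        Filter.atTop (nhds ((∑' k, T.levelWeight p k) ^ (1 - p))) :=
      (ENNReal.continuous_rpow_const.tendsto _).comp ENNReal.summable.hasSum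
    exact ge_of_tendsto' hlim (capacity_univ_le_sum_rpow hT)
  · calc (∑' k, T.levelWeight p k) ^ (1 - p)
      _ = T.visibilityMeasure Set.univ ^ p / energy p T.visibilityMeasure ^ (p - 1) := by
          rw [measure_univ, ENNReal.one_rpow, energy_visibilityMeasure hT, one_div,
            ← ENNReal.rpow_neg, neg_sub]
      _ ≤ T.capacity p Set.univ := measure_rpow_div_energy_rpow_le_capacity _

theorem capacity_univ_ne_top (hT : T.IsSphericallySymmetric) : T.capacity p Set.univ ≠ ∞ := by
  rw [capacity_univ hT, Ne, ENNReal.rpow_eq_top_iff]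
  rintro (⟨h, -⟩ | ⟨-, h⟩)
  · exact tsum_levelWeight_ne_zero h
  · exact (sub_neg.2 hp.out).not_gt h

theorem exists_isEquilibriumFunction (hT : T.IsSphericallySymmetric)
    (h_top : ∑' k, T.levelWeight p k ≠ ∞) :
    ∃ f : T.EdgeLp p, T.IsEquilibriumFunction p Set.univ f ∧
      ∀ α, f α = ((∑' k, T.levelWeight p k)⁻¹ * T.levelWeight p α.toLevel).toReal := by
  obtain ⟨f, hf, hfα, hnorm⟩ := exists_testFunction_of_levelCard_mul_rpow_eq hT
    levelCard_mul_levelWeight_rpow tsum_levelWeight_ne_zero h_top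
  exact ⟨f, ⟨subset_closure hf, hnorm.trans (capacity_univ hT).symm⟩, hfα⟩

theorem copotential_smul_visibilityMeasure (hT : T.IsSphericallySymmetric) (c : ℝ≥0∞)
    (α : T.Edge) : T.copotential (c • T.visibilityMeasure) α =
      (c * (T.levelCard (T.level α) : ℝ≥0∞)⁻¹).toReal := by
  rw [copotential, Measure.real, Measure.smul_apply, visibilityMeasure_tentBoundary hT,
    smul_eq_mul]

theorem isSphericallySymmetricMeasure_smul_visibilityMeasure (hT : T.IsSphericallySymmetric)
    (c : ℝ≥0∞) : T.IsSphericallySymmetricMeasure (c • T.visibilityMeasure) := fun α β h => by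
  rw [copotential_smul_visibilityMeasure hT, copotential_smul_visibilityMeasure hT, h]

theorem copotential_capacity_smul_visibilityMeasure_rpow (hT : T.IsSphericallySymmetric)
    (α : T.Edge) :
    T.copotential (T.capacity p Set.univ • T.visibilityMeasure) α ^ (p.conjExponent - 1) =
      ((∑' k, T.levelWeight p k)⁻¹ * T.levelWeight p α.toLevel).toReal := by
  have hexp : (1 - p) * (p.conjExponent - 1) = -1 := by
    linarith [(Real.HolderConjugate.conjExponent hp.out).mul_eq_add]
  rw [copotential_smul_visibilityMeasure hT, capacity_univ hT, ENNReal.toReal_rpow,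
    ENNReal.mul_rpow_of_nonneg _ _ conjExponent_sub_one_pos.le, ← ENNReal.rpow_mul, hexp,
    ENNReal.rpow_neg_one, ENNReal.inv_rpow, ← ENNReal.rpow_neg, neg_sub]
  rfl

theorem isEquilibriumMeasure_capacity_smul_visibilityMeasure (hT : T.IsSphericallySymmetric) :
    T.IsEquilibriumMeasure p Set.univ (T.capacity p Set.univ • T.visibilityMeasure) := by
  rcases eq_or_ne (∑' k, T.levelWeight p k) ∞ with h_top | h_top
  · have hcap : T.capacity p Set.univ = 0 := by
      rw [capacity_univ hT, h_top, ENNReal.top_rpow_of_neg (sub_neg.2 hp.out)]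
    simpa only [hcap, zero_smul] using isEquilibriumMeasure_zero hcap
  · obtain ⟨f, hf, hfα⟩ := exists_isEquilibriumFunction hT h_top
    exact {
      finite := Measure.smul_finite _ (capacity_univ_ne_top hT)
      support := by simp
      mass := by simp
      equilibrium := ⟨f, fun α =>
        (hfα α).trans (copotential_capacity_smul_visibilityMeasure_rpow hT α).symm, hf⟩ }

end SphericallySymmetric

section Homogeneous

variable {n : ℕ}

theorem levelCard_of_isHomogeneous (hT : T.IsHomogeneous n) (k : ℕ) : T.levelCard k = n ^ k := by
  induction k with
  | zero => rw [levelCard_zero, pow_zero]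
  | succ k ih => rw [levelCard_succ fun α _ => hT α, ih, pow_succ]

theorem tsum_levelWeight_of_isHomogeneous (hn : 1 ≤ n) (hT : T.IsHomogeneous n) {p : ℝ} :
    ∑' k, T.levelWeight p k = (1 - (n : ℝ≥0∞) ^ (1 - p.conjExponent))⁻¹ := by
  have hne (k : ℕ) : T.levelCard k ≠ 0 := by
    rw [levelCard_of_isHomogeneous hT]
    exact pow_ne_zero _ (by omega)
  rw [← ENNReal.tsum_geometric, ← (Equiv.subtypeUnivEquiv hne).tsum_eq]
  refine tsum_congr fun k => ?_
  rw [levelWeight, levelCard_of_isHomogeneous hT, Nat.cast_pow, Equiv.subtypeUnivEquiv_apply,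
    ← ENNReal.rpow_natCast, ← ENNReal.rpow_natCast, ← ENNReal.rpow_mul, ← ENNReal.rpow_mul,
    mul_comm]

theorem capacity_univ_of_isHomogeneous (hn : 1 ≤ n) (hT : T.IsHomogeneous n) {p : ℝ}
    [hp : Fact (1 < p)] :
    T.capacity p Set.univ = ENNReal.ofReal ((1 - (n : ℝ) ^ (1 - p.conjExponent)) ^ (p - 1)) := by
  have hn₀ : (0 : ℝ) < n := by exact_mod_cast hn
  have hle : (n : ℝ) ^ (1 - p.conjExponent) ≤ 1 :=
    Real.rpow_le_one_of_one_le_of_nonpos (by exact_mod_cast hn)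
      (by linarith [conjExponent_sub_one_pos (p := p)])
  rw [capacity_univ fun α β _ => (hT α).trans (hT β).symm, tsum_levelWeight_of_isHomogeneous hn hT,
    ENNReal.inv_rpow, ← ENNReal.rpow_neg, neg_sub,
    ← ENNReal.ofReal_rpow_of_nonneg (sub_nonneg.2 hle) (sub_nonneg.2 hp.out.le),
    ENNReal.ofReal_sub _ (by positivity), ENNReal.ofReal_one, ← ENNReal.ofReal_rpow_of_pos hn₀,
    ENNReal.ofReal_natCast]

end Homogeneous

end RootEdgeTree

theorem mainTheorem11 {V : Type*} (T : RootEdgeTree V) (p : ℝ) [Fact (1 < p)] :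
    (T.IsSphericallySymmetric →
      (∃! μ : MeasureTheory.Measure T.Boundary, T.IsEquilibriumMeasure p Set.univ μ) ∧
      (∀ μ : MeasureTheory.Measure T.Boundary, T.IsEquilibriumMeasure p Set.univ μ →
        T.IsSphericallySymmetricMeasure μ) ∧
      T.capacity p Set.univ =
        (∑' k : {k : ℕ // T.levelCard k ≠ 0},
          (T.levelCard k : ℝ≥0∞) ^ (1 - p.conjExponent)) ^ (1 - p)) ∧
    (∀ n : ℕ, 1 ≤ n → T.IsHomogeneous n →
      T.capacity p Set.univ =
        ENNReal.ofReal ((1 - (n : ℝ) ^ (1 - p.conjExponent)) ^ (p - 1))) := by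
  refine ⟨fun hT => ?_, fun n hn hT => RootEdgeTree.capacity_univ_of_isHomogeneous hn hT⟩
  have hμ := RootEdgeTree.isEquilibriumMeasure_capacity_smul_visibilityMeasure (p := p) hT
  exact ⟨⟨_, hμ, fun ν hν => hν.eq hμ⟩,
    fun ν hν => hν.eq hμ ▸ RootEdgeTree.isSphericallySymmetricMeasure_smul_visibilityMeasure hT _,
    RootEdgeTree.capacity_univ hT⟩
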